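/- Let $1<p<\infty$ and $\alpha,\beta\in\mathbb R$ with $p-1+\beta\neq 0$. Let $(M,g)$ be a complete Riemannian manifold and let $\Omega\subseteq M$ be a domain. Integrals over $\Omega$ are with respect to the Riemannian measure $dV_g$, $|\cdot|$ and $\langle\cdot,\cdot\rangle$ are the norm and inner product of $g$, and $\nabla$ is the (weak) gradient; the gradient $\nabla\rho$ of a positive function $\rho$ which is not locally integrable is understood through truncation, i.e. $\nabla\min(\rho,k)=\mathbf 1_{\{\rho<k\}}\nabla\rho$ weakly for every $k>0$. Let $\rho>0$ a.e. in $\Omega$ be such that $|\nabla\rho|\,\rho^{\frac{-p+\alpha}{p}}\in L^p_{loc}(\Omega)$ and $$\frac{1}{p-1+\beta}\int_\Omega\big\langle\nabla\xi,|\nabla\rho|^{p-2}\nabla\rho\big\rangle\rho^{-p+1+\alpha}\ \ge\ \int_\Omega\frac{|\nabla\rho|^p}{\rho^{p-\alpha}}\,\xi\qquad\text{for all } \xi\in C_c^1(\Omega),\ \xi\ge 0.$$ Suppose that, for some constants $C,K>0$ and with $V=C\,\dfrac{|\nabla\rho|^p}{\rho^p}$, there is a function $\varphi\in W^{1,p}_{loc}(\Omega)$,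 $\varphi>0$ a.e., such that for all $\xi\in C_c^1(\Omega)$ with $\xi\ge0$ $$\int_\Omega\big\langle|\nabla\varphi|^{p-2}\nabla\varphi,\nabla\xi\big\rangle\varphi^{-p+1}\rho^\alpha-(p-1)\int_\Omega|\nabla\varphi|^p\,\xi\,\rho^\alpha\varphi^{-p}-(p-1+\beta)\int_\Omega\big\langle|\nabla\varphi|^{p-2}\nabla\varphi,\nabla\rho\big\rangle\,\xi\,\varphi^{-p+1}\rho^{-1+\alpha}\ \ge\ \int_\Omega\frac{V}{K}\,\xi\,\rho^\alpha ,$$ where the integrals on the left-hand sides of the two displayed conditions are assumed to converge. Then the constant $\left(\frac{|p-1+\beta|}{p}\right)^p$ is not sharp in the Hardy inequality: there is a constant $c>\left(\frac{|p-1+\beta|}{p}\right)^p$ such that $$\int_\Omega|\nabla u|^p\rho^\alpha\,dV_g\ \ge\ c\int_\Omega\frac{|u|^p|\nabla\rho|^p}{\rho^p}\,\rho^\alpha\,dV_g$$ for every $u\in C_c^1(\Omega)$, and more generally for every $u$ in the closure of $C_c^1(\Omega)$ with respect to the norm $\|u\|_{L^p(\Omega)}+\|\nabla u\|_{L^p(\Omega)}+\|\rho^{\alpha/p}\nabla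 u\|_{L^p(\Omega)}$ (this closure is $W^{1,p}_0(\Omega)$ if $\alpha=0$). -/

import Mathlib

open MeasureTheory Filter Topology Bundle
open scoped Manifold ContDiff ENNReal

namespace RiemHardy

noncomputable section

variable {n : ℕ} {M : Type*} [EMetricSpace M] [ChartedSpace (EuclideanSpace ℝ (Fin n)) M]
  [RiemannianBundle (fun x : M => TangentSpace (𝓡 n) x)]

/-- The coordinate vector field in direction `v` of the preferred chart at `x₀`: at the point of `M`
with coordinates `y`, it is the image of `v` under the differential of the inverse chart. -/
def coordVec (x₀ : M) (y v : EuclideanSpace ℝ (Fin n)) :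
    TangentSpace (𝓡 n) ((chartAt (EuclideanSpace ℝ (Fin n)) x₀).symm y) :=
  mfderiv (𝓡 n) (𝓡 n) (chartAt (EuclideanSpace ℝ (Fin n)) x₀).symm y v

/-- The matrix `(g_ij)` of the metric in the preferred chart at `x₀`, at the coordinates `y`. -/
def metricMatrix (x₀ : M) (y : EuclideanSpace ℝ (Fin n)) : Matrix (Fin n) (Fin n) ℝ :=
  Matrix.of fun i j =>
    inner ℝ (coordVec x₀ y (EuclideanSpace.single i 1)) (coordVec x₀ y (EuclideanSpace.single j 1))

/-- The Riemannian measure `√(det g_ij) dy` of the domain of the preferred chart at `x₀`,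
as a measure on `M` that vanishes off that domain. -/
def chartVol (n : ℕ) {M : Type*} [EMetricSpace M] [ChartedSpace (EuclideanSpace ℝ (Fin n)) M]
    [RiemannianBundle (fun x : M => TangentSpace (𝓡 n) x)] [MeasurableSpace M] (x₀ : M) :
    Measure M :=
  ((volume.restrict (chartAt (EuclideanSpace ℝ (Fin n)) x₀).target).withDensity
    (fun y => ENNReal.ofReal (Real.sqrt (metricMatrix x₀ y).det))).map
    (chartAt (EuclideanSpace ℝ (Fin n)) x₀).symm

/-- The Riemannian measure `dV_g`. The chart measures agree on the overlaps of the charts, and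
(on a second countable manifold) the measure on `M` that they glue to is their supremum. -/
def vol (n : ℕ) (M : Type*) [EMetricSpace M] [ChartedSpace (EuclideanSpace ℝ (Fin n)) M]
    [RiemannianBundle (fun x : M => TangentSpace (𝓡 n) x)] [MeasurableSpace M] : Measure M :=
  ⨆ x₀ : M, chartVol n x₀

/-- The gradient of a differentiable function: `⟪∇u(x), w⟫ = du_x(w)` for all tangent vectors. -/
def grad (u : M → ℝ) (x : M) : TangentSpace (𝓡 n) x :=
  haveI : FiniteDimensional ℝ (TangentSpace (𝓡 n) x) :=
    inferInstanceAs (FiniteDimensional ℝ (EuclideanSpace ℝ (Fin n)))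
  haveI : CompleteSpace (TangentSpace (𝓡 n) x) := FiniteDimensional.complete ℝ _
  (InnerProductSpace.toDual ℝ (TangentSpace (𝓡 n) x)).symm (mfderiv (𝓡 n) 𝓘(ℝ, ℝ) u x)

/-- `ξ ∈ C_c^1(Ω)`. -/
def IsTest (n : ℕ) {M : Type*} [EMetricSpace M] [ChartedSpace (EuclideanSpace ℝ (Fin n)) M]
    (Ω : Set M) (ξ : M → ℝ) : Prop :=
  ContMDiff (𝓡 n) 𝓘(ℝ, ℝ) 1 ξ ∧ HasCompactSupport ξ ∧ tsupport ξ ⊆ Ω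

variable [MeasurableSpace M]

/-- A vector field is measurable on `Ω` if its coordinates in charts are. -/
def MeasurableField (Ω : Set M) (X : (x : M) → TangentSpace (𝓡 n) x) : Prop :=
  ∀ x₀ : M, AEStronglyMeasurable
    (fun x => (mfderiv (𝓡 n) (𝓡 n) (chartAt (EuclideanSpace ℝ (Fin n)) x₀) x (X x) :
      EuclideanSpace ℝ (Fin n)))
    ((vol n M).restrict (Ω ∩ (chartAt (EuclideanSpace ℝ (Fin n)) x₀).source))

/-- `u ∈ W^{1,1}_loc(Ω)` with weak gradient `X`: in every chart, the function `y ↦ ⟪X, ∂_v⟫` is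
the weak (distributional) derivative of `u` in the coordinate direction `v`. -/
structure HasWeakGradient (Ω : Set M) (u : M → ℝ) (X : (x : M) → TangentSpace (𝓡 n) x) :
    Prop where
  locallyIntegrable : LocallyIntegrableOn u Ω (vol n M)
  measurable_grad : MeasurableField Ω X
  locallyIntegrable_grad : LocallyIntegrableOn (fun x => ‖X x‖) Ω (vol n M)
  weak_derivative : ∀ (x₀ : M) (v : EuclideanSpace ℝ (Fin n)) (η : EuclideanSpace ℝ (Fin n) → ℝ),
    ContDiff ℝ ∞ η → HasCompactSupport η →
    tsupport η ⊆ (chartAt (EuclideanSpace ℝ (Fin n)) x₀).target ∩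
      (chartAt (EuclideanSpace ℝ (Fin n)) x₀).symm ⁻¹' Ω →
    ∫ y, u ((chartAt (EuclideanSpace ℝ (Fin n)) x₀).symm y) * fderiv ℝ η y v =
      -∫ y, inner ℝ (X ((chartAt (EuclideanSpace ℝ (Fin n)) x₀).symm y)) (coordVec x₀ y v) * η y

/-- The weak gradient of a function that need not be locally integrable, defined by truncation:
for every `k > 0`, `min u k` has the weak gradient `1_{u < k} X`. If `u ∈ W^{1,1}_loc(Ω)` is
nonnegative, this holds for the weak gradient of `u`. -/
def HasTruncGradient (Ω : Set M) (u : M → ℝ) (X : (x : M) → TangentSpace (𝓡 n) x) : Prop :=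
  ∀ k : ℝ, 0 < k →
    HasWeakGradient Ω (fun x => min (u x) k) (fun x => if u x < k then X x else 0)

/-- `φ ∈ W^{1,p}_loc(Ω)` with weak gradient `Φ`. -/
structure InW1pLoc (p : ℝ) (Ω : Set M) (φ : M → ℝ) (Φ : (x : M) → TangentSpace (𝓡 n) x) :
    Prop where
  hasWeakGradient : HasWeakGradient Ω φ Φ
  memLp : LocallyIntegrableOn (fun x => |φ x| ^ p) Ω (vol n M)
  memLp_grad : LocallyIntegrableOn (fun x => ‖Φ x‖ ^ p) Ω (vol n M)

/-- For a positive function `ρ` with gradient `R`, the inequality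
`(p-1+β)⁻¹ ∫_Ω ⟪∇ξ, |∇ρ|^(p-2) ∇ρ⟫ ρ^(-p+1+α) ≥ ∫_Ω |∇ρ|^p / ρ^(p-α) ξ` for all
`0 ≤ ξ ∈ C_c^1(Ω)`, the integral on the left being convergent (the one on the right converges when
`|∇ρ| ρ^((-p+α)/p) ∈ L^p_loc(Ω)`). -/
def RhoCondition (p α β : ℝ) (Ω : Set M) (ρ : M → ℝ) (R : (x : M) → TangentSpace (𝓡 n) x) :
    Prop :=
  ∀ ξ : M → ℝ, IsTest n Ω ξ → (∀ x, 0 ≤ ξ x) →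
    IntegrableOn (fun x => inner ℝ (grad ξ x) (‖R x‖ ^ (p - 2) • R x) * ρ x ^ (-p + 1 + α)) Ω
      (vol n M) ∧
    ∫ x in Ω, ‖R x‖ ^ p / ρ x ^ (p - α) * ξ x ∂(vol n M) ≤
      1 / (p - 1 + β) *
        ∫ x in Ω, inner ℝ (grad ξ x) (‖R x‖ ^ (p - 2) • R x) * ρ x ^ (-p + 1 + α) ∂(vol n M)

/-- For positive functions `ρ`, `φ` with gradients `R`, `Φ`, the inequality
`∫ ⟪|∇φ|^(p-2) ∇φ, ∇ξ⟫ φ^(-p+1) ρ^α - (p-1) ∫ |∇φ|^p ξ ρ^α φ^(-p)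
  - (p-1+β) ∫ ⟪|∇φ|^(p-2) ∇φ, ∇ρ⟫ ξ φ^(-p+1) ρ^(-1+α) ≥ ∫ W ξ ρ^α` over `Ω`, for all
`0 ≤ ξ ∈ C_c^1(Ω)`, the three integrals on the left being convergent. -/
def WeakSupersolution (p α β : ℝ) (Ω : Set M) (ρ : M → ℝ) (R : (x : M) → TangentSpace (𝓡 n) x)
    (φ : M → ℝ) (Φ : (x : M) → TangentSpace (𝓡 n) x) (W : M → ℝ) : Prop :=
  ∀ ξ : M → ℝ, IsTest n Ω ξ → (∀ x, 0 ≤ ξ x) →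
    IntegrableOn (fun x => inner ℝ (‖Φ x‖ ^ (p - 2) • Φ x) (grad ξ x) * φ x ^ (-p + 1) * ρ x ^ α)
      Ω (vol n M) ∧
    IntegrableOn (fun x => ‖Φ x‖ ^ p * ξ x * ρ x ^ α * φ x ^ (-p)) Ω (vol n M) ∧
    IntegrableOn (fun x => inner ℝ (‖Φ x‖ ^ (p - 2) • Φ x) (R x) * ξ x * φ x ^ (-p + 1) *
      ρ x ^ (-1 + α)) Ω (vol n M) ∧
    ∫ x in Ω, W x * ξ x * ρ x ^ α ∂(vol n M) ≤
      (∫ x in Ω, inner ℝ (‖Φ x‖ ^ (p - 2) • Φ x) (grad ξ x) * φ x ^ (-p + 1) * ρ x ^ α ∂(vol n M))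
      - (p - 1) * (∫ x in Ω, ‖Φ x‖ ^ p * ξ x * ρ x ^ α * φ x ^ (-p) ∂(vol n M))
      - (p - 1 + β) * (∫ x in Ω, inner ℝ (‖Φ x‖ ^ (p - 2) • Φ x) (R x) * ξ x * φ x ^ (-p + 1) *
          ρ x ^ (-1 + α) ∂(vol n M))

/-- `u`, with gradient `U`, lies in the closure of `C_c^1(Ω)` for the norm
`‖u‖_{L^p(Ω)} + ‖∇u‖_{L^p(Ω)} + ‖ρ^(α/p) ∇u‖_{L^p(Ω)}` (then `U` is the weak gradient of `u`).
This closure contains `C_c^1(Ω)`, and it is the Sobolev space `W^{1,p}_0(Ω)` if `α = 0`. -/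
structure InW1pZero (p α : ℝ) (Ω : Set M) (ρ : M → ℝ) (u : M → ℝ)
    (U : (x : M) → TangentSpace (𝓡 n) x) : Prop where
  measurable : AEStronglyMeasurable u ((vol n M).restrict Ω)
  measurable_grad : MeasurableField Ω U
  exists_approx : ∃ f : ℕ → M → ℝ, (∀ k, IsTest n Ω (f k)) ∧
    Tendsto (fun k => ∫⁻ x in Ω, ENNReal.ofReal (|f k x - u x| ^ p) ∂(vol n M)) atTop (𝓝 0) ∧
    Tendsto (fun k => ∫⁻ x in Ω, ENNReal.ofReal (‖grad (f k) x - U x‖ ^ p * (1 + ρ x ^ α))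
      ∂(vol n M)) atTop (𝓝 0)

/-- The Hardy inequality with constant `c`:
`∫_Ω |∇u|^p ρ^α ≥ c ∫_Ω |u|^p |∇ρ|^p / ρ^p ρ^α`, with integrals valued in `[0, ∞]`, for all `u`
in the closure of `C_c^1(Ω)` described above. -/
def HardyInequality (p α : ℝ) (Ω : Set M) (ρ : M → ℝ) (R : (x : M) → TangentSpace (𝓡 n) x)
    (c : ℝ) : Prop :=
  ∀ (u : M → ℝ) (U : (x : M) → TangentSpace (𝓡 n) x), InW1pZero p α Ω ρ u U →
    ENNReal.ofReal c *
        ∫⁻ x in Ω, ENNReal.ofReal (|u x| ^ p * ‖R x‖ ^ p / ρ x ^ p * ρ x ^ α) ∂(vol n M) ≤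
      ∫⁻ x in Ω, ENNReal.ofReal (‖U x‖ ^ p * ρ x ^ α) ∂(vol n M)

end

end RiemHardy

namespace RiemHardy

/-! Write `γ = (p - 1 + β) / p`. For a test function `u`, split `∇u = a + b` with `a = γ (u/ρ) ∇ρ`.
Convexity of `‖·‖ ^ p` gives `‖a + b‖ ^ p ≥ ‖a‖ ^ p + p ‖a‖ ^ (p - 2) ⟪a, b⟫`; after multiplication
by `ρ ^ α` and integration, the condition on `ρ` tested with `ξ = |u| ^ p` turns this into the Hardy
inequality with constant `|γ| ^ p`.

The improvement comes from what convexity discards. By `exists_norm_add_rpow_ge` one may add `δ (‖b‖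
^ p - ε ‖a‖ ^ p)`, where `δ > 0` depends only on `p` and `ε`, hence not on the tangent space.
Young's inequality `norm_rpow_ge` bounds `‖b‖ ^ p` below through the vector `(u/φ) ∇φ`, and the
result is exactly the left side of the supersolution inequality with `ξ = |u| ^ p`. The constant
becomes `|γ| ^ p + δ (C/K - ε |γ| ^ p)`, which is larger than `|γ| ^ p` for small `ε`
(`IsTest.hardy`). Fatou's lemma and density then pass to the closure (`hardyInequality_of_isTest`).
-/

/-! ### Quantitative strict convexity of `‖·‖ ^ p`. -/

/-- Bernoulli's inequality; below `-1` the left side is negative because `p > 1`. -/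
theorem one_add_mul_lt_abs_rpow {p z : ℝ} (hp : 1 < p) (hz : z ≠ 0) : 1 + p * z < |1 + z| ^ p := by
  rcases le_or_gt (-1) z with h | h
  · rw [abs_of_nonneg (by linarith)]
    exact one_add_mul_self_lt_rpow_one_add h hz hp
  · have : 0 ≤ |1 + z| ^ p := by positivity
    nlinarith

/-- Strict convexity of `‖·‖ ^ p`, in terms of norms `x`, `s` and the cosine `t`. -/
theorem rpow_add_mul_lt {p x s t : ℝ} (hp : 1 < p) (hx : 0 ≤ x) (hs : 0 < s) (ht : |t| ≤ 1) :
    x ^ p + p * x ^ (p - 1) * s * t < (x ^ 2 + 2 * x * s * t + s ^ 2) ^ (p / 2) := by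
  have ht2 : t ^ 2 ≤ 1 := (sq_le_one_iff_abs_le_one t).2 ht
  have key : ∀ y : ℝ, 0 ≤ y → (y ^ 2) ^ (p / 2) = y ^ p := fun y hy => by
    rw [← Real.rpow_natCast, ← Real.rpow_mul hy]
    congr 1
    push_cast
    ring
  rcases hx.eq_or_lt with rfl | hx
  · rw [Real.zero_rpow (by linarith), Real.zero_rpow (by linarith)]
    have : (0 : ℝ) ^ 2 + 2 * 0 * s * t + s ^ 2 = s ^ 2 := by ring
    rw [this, key s hs.le]
    have : 0 < s ^ p := by positivity
    simpa
  · set y := s / x with hy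
    have hy0 : 0 < y := by positivity
    have hsy : s = x * y := by rw [hy]; field_simp
    have e1 : x ^ 2 + 2 * x * s * t + s ^ 2 = x ^ 2 * ((1 + y * t) ^ 2 + y ^ 2 * (1 - t ^ 2)) := by
      rw [hsy]; ring
    have e2 : x ^ p + p * x ^ (p - 1) * s * t = x ^ p * (1 + p * (y * t)) := by
      have : x ^ p = x ^ (p - 1) * x := by
        rw [← Real.rpow_add_one hx.ne']; congr 1; ring
      rw [this, hsy]; ring
    have hn : 0 ≤ y ^ 2 * (1 - t ^ 2) := mul_nonneg (by positivity) (by linarith)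
    rw [e1, e2, Real.mul_rpow (by positivity) (by positivity), key x hx.le]
    refine mul_lt_mul_of_pos_left ?_ (by positivity)
    -- Bernoulli is strict only for `y * t ≠ 0`; at `t = 0` the strictness comes from the orthogonal
    -- part `y ^ 2`.
    rcases eq_or_ne t 0 with rfl | ht0
    · simp only [mul_zero, add_zero]
      refine Real.one_lt_rpow ?_ (by linarith)
      nlinarith
    · refine (one_add_mul_lt_abs_rpow hp (mul_ne_zero hy0.ne' ht0)).trans_le ?_
      rw [← key _ (abs_nonneg _), sq_abs]
      exact Real.rpow_le_rpow (by positivity) (by linarith) (by linarith)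

/-- A uniform version of strict convexity. -/
theorem exists_rpow_add_mul_le {p ε : ℝ} (hp : 1 < p) (hε : 0 < ε) :
    ∃ δ : ℝ, 0 < δ ∧ ∀ x t : ℝ, 0 ≤ x → x ≤ 1 → |t| ≤ 1 →
      x ^ p + p * x ^ (p - 1) * (1 - x) * t + δ * ((1 - x) ^ p - ε * x ^ p) ≤
        (x ^ 2 + 2 * x * (1 - x) * t + (1 - x) ^ 2) ^ (p / 2) := by
  set h : ℝ × ℝ → ℝ := fun z => (z.1 ^ 2 + 2 * z.1 * (1 - z.1) * z.2 + (1 - z.1) ^ 2) ^ (p / 2) -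
    (z.1 ^ p + p * z.1 ^ (p - 1) * (1 - z.1) * z.2) with hh
  have c1 : Continuous fun z : ℝ × ℝ => z.1 ^ p :=
    continuous_fst.rpow_const fun _ => Or.inr (by linarith)
  have c2 : Continuous fun z : ℝ × ℝ => z.1 ^ (p - 1) :=
    continuous_fst.rpow_const fun _ => Or.inr (by linarith)
  have c3 : Continuous fun z : ℝ × ℝ => (1 - z.1) ^ p :=
    (continuous_const.sub continuous_fst).rpow_const fun _ => Or.inr (by linarith)
  have c4 : Continuous fun z : ℝ × ℝ =>
      (z.1 ^ 2 + 2 * z.1 * (1 - z.1) * z.2 + (1 - z.1) ^ 2) ^ (p / 2) :=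
    Continuous.rpow_const (by fun_prop) fun _ => Or.inr (by linarith)
  have hc : Continuous h := by rw [hh]; fun_prop
  -- `S` is where the bracket multiplying `δ` is nonnegative; off `S` plain convexity suffices. The
  -- point `x = 1`, where strictness fails, is not in `S` since `ε > 0`, so the convexity gap `h`
  -- has a positive minimum there, and this is `δ`. The bracket is at most `1`.
  set S : Set (ℝ × ℝ) := (Set.Icc 0 1 ×ˢ Set.Icc (-1) 1) ∩ {z | ε * z.1 ^ p ≤ (1 - z.1) ^ p}
  have hS : IsCompact S :=
    (isCompact_Icc.prod isCompact_Icc).inter_right (isClosed_le (by fun_prop) c3)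
  have hne : S.Nonempty := ⟨(0, 0), by simp [S, Real.zero_rpow (by linarith : p ≠ 0)]⟩
  obtain ⟨z₀, hz₀, hmin⟩ := hS.exists_isMinOn hne hc.continuousOn
  have hpos : 0 < h z₀ := by
    obtain ⟨⟨⟨h1, h2⟩, h3⟩, h4⟩ := hz₀
    rcases h2.eq_or_lt with h2 | h2
    · simp only [Set.mem_ofPred_eq, h2, sub_self, Real.one_rpow,
        Real.zero_rpow (by linarith : p ≠ 0)] at h4
      linarith
    · exact sub_pos.2 (rpow_add_mul_lt hp h1 (by linarith) (abs_le.2 h3))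
  refine ⟨h z₀, hpos, fun x t hx0 hx1 ht => ?_⟩
  have hxp : 0 ≤ x ^ p := by positivity
  have hle : (1 - x) ^ p ≤ 1 := Real.rpow_le_one (by linarith) (by linarith) (by linarith)
  by_cases hmem : ε * x ^ p ≤ (1 - x) ^ p
  · have h1 : h z₀ ≤ h (x, t) := hmin ⟨⟨⟨hx0, hx1⟩, abs_le.1 ht⟩, hmem⟩
    have h2 : h z₀ * ((1 - x) ^ p - ε * x ^ p) ≤ h z₀ * 1 := by
      refine mul_le_mul_of_nonneg_left ?_ hpos.le
      nlinarith
    have h3 : h (x, t) = (x ^ 2 + 2 * x * (1 - x) * t + (1 - x) ^ 2) ^ (p / 2) -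
      (x ^ p + p * x ^ (p - 1) * (1 - x) * t) := rfl
    linarith
  · have h2 : h z₀ * ((1 - x) ^ p - ε * x ^ p) ≤ 0 :=
      mul_nonpos_of_nonneg_of_nonpos hpos.le (by linarith)
    rcases hx1.eq_or_lt with rfl | hx1
    · simp only [sub_self] at h2 ⊢
      norm_num at h2 ⊢
      linarith
    · have := rpow_add_mul_lt hp hx0 (sub_pos.2 hx1) ht
      linarith

/-- A uniform version of the strict convexity of `‖·‖ ^ p` in inner product spaces. -/
theorem exists_norm_add_rpow_ge {p ε : ℝ} (hp : 1 < p) (hε : 0 < ε) :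
    ∃ δ : ℝ, 0 < δ ∧ ∀ (E : Type*) [NormedAddCommGroup E] [InnerProductSpace ℝ E] (a b : E),
      ‖a‖ ^ p + p * (‖a‖ ^ (p - 2) * inner ℝ a b) + δ * (‖b‖ ^ p - ε * ‖a‖ ^ p) ≤ ‖a + b‖ ^ p := by
  obtain ⟨δ, hδ, H⟩ := exists_rpow_add_mul_le hp hε
  refine ⟨δ, hδ, fun E _ _ a b => ?_⟩
  rcases (add_nonneg (norm_nonneg a) (norm_nonneg b)).eq_or_lt with h0 | hl
  · have ha : ‖a‖ = 0 := by linarith [norm_nonneg a, norm_nonneg b]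
    have hb : ‖b‖ = 0 := by linarith [norm_nonneg a, norm_nonneg b]
    rw [norm_eq_zero] at ha hb
    simp [ha, hb, Real.zero_rpow (by linarith : p ≠ 0)]
  -- Both sides are homogeneous of degree `p`, so the sum of the norms may be scaled to `1`; `t` is
  -- the cosine of the angle.
  set l := ‖a‖ + ‖b‖ with hldef
  set x := ‖a‖ / l with hx
  have hax : ‖a‖ = l * x := by rw [hx]; field_simp
  have hbx : ‖b‖ = l * (1 - x) := by rw [mul_sub, ← hax, hldef]; ring
  have hx0 : 0 ≤ x := by positivity
  have hx1 : x ≤ 1 := by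
    rw [hx, div_le_one hl]; linarith [norm_nonneg b]
  set t := inner ℝ a b / (‖a‖ * ‖b‖) with ht
  have hin : inner ℝ a b = ‖a‖ * ‖b‖ * t := by
    rcases eq_or_ne (‖a‖ * ‖b‖) 0 with h | h
    · rw [h, zero_mul]
      rcases mul_eq_zero.1 h with h | h <;> simp [norm_eq_zero.1 h]
    · rw [ht, mul_div_cancel₀ _ h]
  have ht1 : |t| ≤ 1 := abs_real_inner_div_norm_mul_norm_le_one a b
  have hsum : ‖a + b‖ ^ p = l ^ p * (x ^ 2 + 2 * x * (1 - x) * t + (1 - x) ^ 2) ^ (p / 2) := by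
    have h1 : ‖a + b‖ ^ 2 = l ^ 2 * (x ^ 2 + 2 * x * (1 - x) * t + (1 - x) ^ 2) := by
      rw [norm_add_sq_real, hin, hax, hbx]; ring
    have h2 : 0 ≤ x ^ 2 + 2 * x * (1 - x) * t + (1 - x) ^ 2 := by
      nlinarith [sq_nonneg ‖a + b‖, sq_pos_of_pos hl]
    have h3 : ∀ y : ℝ, 0 ≤ y → y ^ p = (y ^ 2) ^ (p / 2) := fun y hy => by
      rw [← Real.rpow_natCast, ← Real.rpow_mul hy]
      congr 1
      push_cast
      ring
    rw [h3 _ (norm_nonneg _), h1, Real.mul_rpow (by positivity) h2, ← h3 l hl.le]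
  have hcross : ‖a‖ ^ (p - 2) * inner ℝ a b = l ^ p * (x ^ (p - 1) * (1 - x) * t) := by
    rcases hx0.eq_or_lt with h | h
    · rw [hin, hax, ← h, Real.zero_rpow (by linarith)]; ring
    · have e1 : x ^ (p - 1) = x ^ (p - 2) * x := by
        rw [← Real.rpow_add_one h.ne']; congr 1; ring
      have e2 : l ^ p = l ^ (p - 2) * l ^ 2 := by
        rw [← Real.rpow_natCast, ← Real.rpow_add hl]; congr 1; push_cast; ring
      rw [hin, hbx, hax, Real.mul_rpow hl.le hx0, e1, e2]; ring
  rw [hsum, hcross, hbx, hax, Real.mul_rpow hl.le hx0, Real.mul_rpow hl.le (by linarith)]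
  have := mul_le_mul_of_nonneg_left (H x t hx0 hx1 ht1) (Real.rpow_nonneg hl.le p)
  linarith

/-- Young's inequality for `‖b‖ ^ p`. -/
theorem norm_rpow_ge {E : Type*} [NormedAddCommGroup E] [InnerProductSpace ℝ E] {p : ℝ} (hp : 1 < p) (c b : E) :
    p * (‖c‖ ^ (p - 2) * inner ℝ c b) - (p - 1) * ‖c‖ ^ p ≤ ‖b‖ ^ p := by
  have hb : 0 ≤ ‖b‖ ^ p := by positivity
  rcases (norm_nonneg c).eq_or_lt with h | h
  · rw [norm_eq_zero.1 h.symm, norm_zero, Real.zero_rpow (by linarith : p ≠ 0)]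
    simpa using hb
  · have e1 : ‖c‖ ^ p = ‖c‖ ^ (p - 2) * ‖c‖ ^ 2 := by
      rw [← Real.rpow_natCast, ← Real.rpow_add h]; congr 1; push_cast; ring
    have hy : 0 ≤ ‖b‖ / ‖c‖ := by positivity
    have h1 : 1 + p * (‖b‖ / ‖c‖ - 1) ≤ (‖b‖ / ‖c‖) ^ p := by
      have := one_add_mul_self_le_rpow_one_add (s := ‖b‖ / ‖c‖ - 1) (by linarith) hp.le
      simpa using this
    have h2 : ‖b‖ ^ p = ‖c‖ ^ p * (‖b‖ / ‖c‖) ^ p := by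
      rw [← Real.mul_rpow h.le hy]; congr 1; field_simp
    have h3 : ‖c‖ ^ p * (‖b‖ / ‖c‖) = ‖c‖ ^ (p - 2) * (‖c‖ * ‖b‖) := by
      rw [e1]; field_simp
    have h4 := mul_le_mul_of_nonneg_left h1 (Real.rpow_nonneg h.le p)
    have h5 : ‖c‖ ^ (p - 2) * inner ℝ c b ≤ ‖c‖ ^ (p - 2) * (‖c‖ * ‖b‖) :=
      mul_le_mul_of_nonneg_left (real_inner_le_norm c b) (by positivity)
    rw [h2]
    nlinarith

/-! ### The pointwise inequality. -/

section Pointwise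

variable {E : Type*} [NormedAddCommGroup E] [InnerProductSpace ℝ E]

theorem abs_rpow_sub_two_mul_mul_self {p : ℝ} (hp : p ≠ 0) (u : ℝ) :
    |u| ^ (p - 2) * u * u = |u| ^ p := by
  rcases eq_or_ne u 0 with rfl | hu
  · simp [Real.zero_rpow hp]
  · rw [mul_assoc, ← abs_mul_abs_self u, ← sq, ← Real.rpow_natCast,
      ← Real.rpow_add (abs_pos.2 hu)]
    congr 1
    push_cast
    ring

theorem norm_smul_rpow_mul_inner (p k : ℝ) (w v : E) :
    ‖k • w‖ ^ (p - 2) * inner ℝ (k • w) v =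
      |k| ^ (p - 2) * k * inner ℝ (‖w‖ ^ (p - 2) • w) v := by
  rw [norm_smul, Real.norm_eq_abs, Real.mul_rpow (abs_nonneg _) (norm_nonneg _),
    real_inner_smul_left, real_inner_smul_left]
  ring

theorem abs_rpow_mul_of_div {p u f : ℝ} (hf : 0 < f) :
    |u / f| ^ (p - 2) * (u / f) = |u| ^ (p - 2) * u * f ^ (-p + 1) := by
  have : f ^ (-p + 1) = (f ^ (p - 2))⁻¹ * f⁻¹ := by
    rw [← Real.rpow_neg hf.le, ← Real.rpow_neg_one f, ← Real.rpow_add hf]; congr 1; ring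
  rw [abs_div, abs_of_pos hf, Real.div_rpow (abs_nonneg _) hf.le, this]
  ring

/-- The pointwise inequality behind the improved Hardy inequality. -/
theorem pointwise_hardy {p ε δ : ℝ} (hp : 1 < p) (hδ : 0 < δ)
    (H : ∀ a b : E, ‖a‖ ^ p + p * (‖a‖ ^ (p - 2) * inner ℝ a b) +
      δ * (‖b‖ ^ p - ε * ‖a‖ ^ p) ≤ ‖a + b‖ ^ p)
    (g R Φ : E) (u γ α : ℝ) {r f : ℝ} (hr : 0 < r) (hf : 0 < f) :
    |γ| ^ (p - 2) * γ * (inner ℝ ((p * |u| ^ (p - 2) * u) • g) (‖R‖ ^ (p - 2) • R) *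
        r ^ (-p + 1 + α)) - (p - 1) * |γ| ^ p * (‖R‖ ^ p / r ^ (p - α) * |u| ^ p) +
      δ * (inner ℝ (‖Φ‖ ^ (p - 2) • Φ) ((p * |u| ^ (p - 2) * u) • g) * f ^ (-p + 1) * r ^ α -
        (p - 1) * (‖Φ‖ ^ p * |u| ^ p * r ^ α * f ^ (-p)) -
        p * γ * (inner ℝ (‖Φ‖ ^ (p - 2) • Φ) R * |u| ^ p * f ^ (-p + 1) * r ^ (-1 + α)) -
        ε * |γ| ^ p * (‖R‖ ^ p / r ^ (p - α) * |u| ^ p)) ≤ ‖g‖ ^ p * r ^ α := by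
  -- The deviation of `g = ∇u` from the vector field of the extremal case `u = ρ ^ γ`.
  set b := g - (γ * (u / r)) • R with hb
  have hp0 : p ≠ 0 := by linarith
  have h1 := H ((γ * (u / r)) • R) b
  have h2 := norm_rpow_ge hp ((u / f) • Φ) b
  rw [hb, add_sub_cancel, ← hb] at h1
  have na : ‖(γ * (u / r)) • R‖ ^ p = |γ| ^ p * (‖R‖ ^ p * |u| ^ p * r ^ (-p)) := by
    rw [norm_smul, Real.norm_eq_abs, abs_mul, abs_div, abs_of_pos hr,
      Real.mul_rpow (by positivity) (norm_nonneg _), Real.mul_rpow (by positivity) (by positivity),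
      Real.div_rpow (abs_nonneg _) hr.le, Real.rpow_neg hr.le]
    ring
  have nc : ‖(u / f) • Φ‖ ^ p = ‖Φ‖ ^ p * |u| ^ p * f ^ (-p) := by
    rw [norm_smul, Real.norm_eq_abs, abs_div, abs_of_pos hf,
      Real.mul_rpow (by positivity) (norm_nonneg _),
      Real.div_rpow (abs_nonneg _) hf.le, Real.rpow_neg hf.le]
    ring
  have ia : ‖(γ * (u / r)) • R‖ ^ (p - 2) * inner ℝ ((γ * (u / r)) • R) b =
      |γ| ^ (p - 2) * γ * (|u| ^ (p - 2) * u * inner ℝ g (‖R‖ ^ (p - 2) • R) * r ^ (-p + 1)) -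
        ‖(γ * (u / r)) • R‖ ^ p := by
    have : ‖(γ * (u / r)) • R‖ ^ p =
        ‖(γ * (u / r)) • R‖ ^ (p - 2) * inner ℝ ((γ * (u / r)) • R) ((γ * (u / r)) • R) := by
      have := abs_rpow_sub_two_mul_mul_self hp0 ‖(γ * (u / r)) • R‖
      rw [abs_norm, mul_assoc] at this
      rw [real_inner_self_eq_norm_mul_norm, this]
    rw [this, hb, inner_sub_right, mul_sub, sub_left_inj, norm_smul_rpow_mul_inner,
      real_inner_comm, abs_mul, Real.mul_rpow (abs_nonneg _) (abs_nonneg _)]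
    have := abs_rpow_mul_of_div (p := p) (u := u) hr
    linear_combination (|γ| ^ (p - 2) * γ * inner ℝ g (‖R‖ ^ (p - 2) • R)) * this
  have ic : ‖(u / f) • Φ‖ ^ (p - 2) * inner ℝ ((u / f) • Φ) b =
      |u| ^ (p - 2) * u * inner ℝ (‖Φ‖ ^ (p - 2) • Φ) g * f ^ (-p + 1) -
        γ * (inner ℝ (‖Φ‖ ^ (p - 2) • Φ) R * |u| ^ p * f ^ (-p + 1) * r⁻¹) := by
    rw [norm_smul_rpow_mul_inner, abs_rpow_mul_of_div hf, hb, inner_sub_right,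
      real_inner_smul_right, ← abs_rpow_sub_two_mul_mul_self hp0 u]
    ring
  rw [ia, na] at h1
  rw [ic, nc] at h2
  have r1 : r ^ (-p + 1 + α) = r ^ (-p + 1) * r ^ α := Real.rpow_add hr _ _
  have r2 : ‖R‖ ^ p / r ^ (p - α) = ‖R‖ ^ p * r ^ (-p) * r ^ α := by
    rw [mul_assoc, ← Real.rpow_add hr, div_eq_mul_inv, ← Real.rpow_neg hr.le]
    congr 2; ring
  have r3 : r ^ (-1 + α) = r⁻¹ * r ^ α := by rw [Real.rpow_add hr, Real.rpow_neg_one]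
  rw [r1, r2, r3]
  have h3 := mul_le_mul_of_nonneg_right (mul_le_mul_of_nonneg_left h2 hδ.le)
    (Real.rpow_nonneg hr.le α)
  have h4 := mul_le_mul_of_nonneg_right h1 (Real.rpow_nonneg hr.le α)
  simp only [real_inner_smul_left, real_inner_smul_right] at h3 h4 ⊢
  linarith

/-- Convexity of `t ^ p` at `x / l` and `y / (1 - l)`. The coefficient of `x ^ p` tends to `1` as `l
→ 1`. -/
theorem add_rpow_le {p : ℝ} (hp : 1 ≤ p) {l x y : ℝ} (hl0 : 0 < l) (hl1 : l < 1)
    (hx : 0 ≤ x) (hy : 0 ≤ y) :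
    (x + y) ^ p ≤ l ^ (1 - p) * x ^ p + (1 - l) ^ (1 - p) * y ^ p := by
  have hl2 : 0 < 1 - l := by linarith
  have h := (convexOn_rpow hp).2 (x := x / l) (y := y / (1 - l)) (by simp; positivity)
    (by simp; positivity) hl0.le hl2.le (by ring)
  simp only [smul_eq_mul] at h
  rw [mul_div_cancel₀ _ hl0.ne', mul_div_cancel₀ _ hl2.ne', Real.div_rpow hx hl0.le,
    Real.div_rpow hy hl2.le] at h
  rw [Real.rpow_sub hl0, Real.rpow_sub hl2, Real.rpow_one, Real.rpow_one]
  exact h.trans_eq (by ring)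

end Pointwise

/-! ### Test functions and the inequality on them. -/

section Test

variable {n : ℕ} {M : Type*} [EMetricSpace M] [ChartedSpace (EuclideanSpace ℝ (Fin n)) M]

/-- For `p > 1` the function `|t| ^ p` is `C^1`, so `|u| ^ p` is an admissible `ξ` even where `u`
changes sign. -/
theorem IsTest.abs_rpow {Ω : Set M} {u : M → ℝ} (hu : IsTest n Ω u) {p : ℝ} (hp : 1 < p) :
    IsTest n Ω (fun x => |u x| ^ p) := by
  obtain ⟨h1, h2, h3⟩ := hu
  have h0 : (fun t : ℝ => |t| ^ p) 0 = 0 := by simp [Real.zero_rpow (by linarith : p ≠ 0)]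
  refine ⟨?_, h2.comp_left (g := fun t : ℝ => |t| ^ p) h0,
    (tsupport_comp_subset (g := fun t : ℝ => |t| ^ p) h0 u).trans h3⟩
  exact ((contDiff_norm_rpow (E := ℝ) hp).contMDiff).comp h1

variable [RiemannianBundle (fun x : M => TangentSpace (𝓡 n) x)]

theorem inner_grad (u : M → ℝ) (x : M) (w : TangentSpace (𝓡 n) x) :
    inner ℝ (grad u x : TangentSpace (𝓡 n) x) w = mfderiv (𝓡 n) 𝓘(ℝ, ℝ) u x w := by
  have : FiniteDimensional ℝ (TangentSpace (𝓡 n) x) :=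
    inferInstanceAs (FiniteDimensional ℝ (EuclideanSpace ℝ (Fin n)))
  have : CompleteSpace (TangentSpace (𝓡 n) x) := FiniteDimensional.complete ℝ _
  exact InnerProductSpace.toDual_symm_apply

theorem grad_abs_rpow {u : M → ℝ} {x : M} (hu : MDifferentiableAt (𝓡 n) 𝓘(ℝ, ℝ) u x) {p : ℝ}
    (hp : 1 < p) :
    grad (fun x => |u x| ^ p) x =
      (p * |u x| ^ (p - 2) * u x) • (grad u x : TangentSpace (𝓡 n) x) := by
  have h := ((hasDerivAt_abs_rpow (u x) hp).hasFDerivAt.hasMFDerivAt.comp x hu.hasMFDerivAt).mfderiv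
  refine ext_inner_right ℝ fun w => ?_
  rw [real_inner_smul_left, inner_grad, inner_grad]
  refine (congrArg (fun L => L w) h).trans ?_
  exact mul_comm (G := ℝ) _ _

end Test

/-- Only the lower bound `L` must be integrable: the weighted energy `N` is allowed to have infinite
integral. -/
theorem ofReal_integral_le_lintegral {X : Type*} [MeasurableSpace X] {μ : Measure X} {L N : X → ℝ}
    (hL : Integrable L μ) (h : ∀ᵐ x ∂μ, L x ≤ N x) :
    ENNReal.ofReal (∫ x, L x ∂μ) ≤ ∫⁻ x, ENNReal.ofReal (N x) ∂μ := by
  calc ENNReal.ofReal (∫ x, L x ∂μ) ≤ ENNReal.ofReal (∫ x, max (L x) 0 ∂μ) :=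
        ENNReal.ofReal_le_ofReal (integral_mono hL hL.pos_part fun x => le_max_left _ _)
    _ = ∫⁻ x, ENNReal.ofReal (max (L x) 0) ∂μ :=
        ofReal_integral_eq_lintegral_ofReal hL.pos_part (ae_of_all _ fun x => le_max_right _ _)
    _ ≤ ∫⁻ x, ENNReal.ofReal (N x) ∂μ := by
        refine lintegral_mono_ae (h.mono fun x hx => ?_)
        rw [ENNReal.ofReal_max, ENNReal.ofReal_zero, max_eq_left zero_le]
        exact ENNReal.ofReal_le_ofReal hx

variable {n : ℕ} {M : Type*} [EMetricSpace M] [ChartedSpace (EuclideanSpace ℝ (Fin n)) M]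
  [RiemannianBundle (fun x : M => TangentSpace (𝓡 n) x)] [MeasurableSpace M]

theorem IsTest.integrableOn_mul [BorelSpace M] [SecondCountableTopology M] {Ω : Set M} {ξ : M → ℝ}
    (hΩ : IsOpen Ω) (hξ : IsTest n Ω ξ) {f : M → ℝ}
    (hf : LocallyIntegrableOn f Ω (vol n M)) :
    IntegrableOn (fun x => f x * ξ x) Ω (vol n M) := by
  obtain ⟨h1, h2, h3⟩ := hξ
  have hK : IntegrableOn (fun x => f x * ξ x) (tsupport ξ) (vol n M) :=
    (hf.integrableOn_compact_subset h3 h2).mul_continuousOn h1.continuous.continuousOn h2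
  refine hK.of_forall_sdiff_eq_zero hΩ.measurableSet fun x hx => ?_
  rw [image_eq_zero_of_notMem_tsupport hx.2, mul_zero]

/-- Integrates `pointwise_hardy` and applies both integral hypotheses with `ξ = |u| ^ p`. -/
theorem IsTest.hardy [BorelSpace M] [SecondCountableTopology M] {Ω : Set M} (hΩ : IsOpen Ω)
    {p α β : ℝ} (hp : 1 < p) (hβ : p - 1 + β ≠ 0)
    {ρ : M → ℝ} {R : (x : M) → TangentSpace (𝓡 n) x}
    (hρpos : ∀ᵐ x ∂((vol n M).restrict Ω), 0 < ρ x)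
    (hRint : LocallyIntegrableOn (fun x => ‖R x‖ ^ p / ρ x ^ (p - α)) Ω (vol n M))
    (hρ : RhoCondition p α β Ω ρ R) {κ δ : ℝ} (hδ : 0 < δ)
    {φ : M → ℝ} {Φ : (x : M) → TangentSpace (𝓡 n) x}
    (hφpos : ∀ᵐ x ∂((vol n M).restrict Ω), 0 < φ x)
    (hode : WeakSupersolution p α β Ω ρ R φ Φ (fun x => κ * (‖R x‖ ^ p / ρ x ^ p)))
    {ε : ℝ} (H : ∀ (x : M) (a b : TangentSpace (𝓡 n) x),
      ‖a‖ ^ p + p * (‖a‖ ^ (p - 2) * inner ℝ a b) +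
      δ * (‖b‖ ^ p - ε * ‖a‖ ^ p) ≤ ‖a + b‖ ^ p) {u : M → ℝ} (hu : IsTest n Ω u) :
    ENNReal.ofReal ((|p - 1 + β| / p) ^ p + δ * (κ - ε * (|p - 1 + β| / p) ^ p)) *
      ∫⁻ x in Ω, ENNReal.ofReal (|u x| ^ p * ‖R x‖ ^ p / ρ x ^ p * ρ x ^ α) ∂(vol n M) ≤
    ∫⁻ x in Ω, ENNReal.ofReal (‖(grad u x : TangentSpace (𝓡 n) x)‖ ^ p * ρ x ^ α) ∂(vol n M) := by
  have hp0 : 0 < p := by linarith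
  set γ := (p - 1 + β) / p with hγ
  have hγp : p - 1 + β = p * γ := by rw [hγ]; field_simp
  have hγ0 : γ ≠ 0 := div_ne_zero hβ hp0.ne'
  have habs : |p - 1 + β| / p = |γ| := by rw [hγ, abs_div, abs_of_pos hp0]
  rw [habs]
  have hξ := hu.abs_rpow hp
  have hξ0 : ∀ x, 0 ≤ |u x| ^ p := fun x => by positivity
  obtain ⟨i1, le1⟩ := hρ _ hξ hξ0
  obtain ⟨i2, i3, i4, le2⟩ := hode _ hξ hξ0
  have i0 := hξ.integrableOn_mul hΩ hRint
  rw [hγp] at le1 le2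
  set A := ∫ x in Ω, ‖R x‖ ^ p / ρ x ^ (p - α) * |u x| ^ p ∂(vol n M) with hA
  -- The Hardy integral is finite because `|u| ^ p` has compact support in `Ω`, so the rest is real
  -- arithmetic.
  have eA : ∫⁻ x in Ω, ENNReal.ofReal (|u x| ^ p * ‖R x‖ ^ p / ρ x ^ p * ρ x ^ α) ∂(vol n M) =
      ENNReal.ofReal A := by
    rw [hA, ofReal_integral_eq_lintegral_ofReal i0]
    · refine lintegral_congr_ae (hρpos.mono fun x hx => ?_)
      simp only
      rw [Real.rpow_sub hx]
      congr 1
      field_simp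
    · filter_upwards [hρpos] with x hx
      simp only [Pi.zero_apply]
      positivity
  have eW : ∫ x in Ω, κ * (‖R x‖ ^ p / ρ x ^ p) * |u x| ^ p * ρ x ^ α ∂(vol n M) = κ * A := by
    rw [hA, ← integral_const_mul]
    refine integral_congr_ae (hρpos.mono fun x hx => ?_)
    simp only
    rw [Real.rpow_sub hx]
    field_simp
  rw [eW] at le2
  have hA0 : 0 ≤ A := by
    refine integral_nonneg_of_ae ?_
    filter_upwards [hρpos] with x hx
    simp only [Pi.zero_apply]
    positivity
  rw [eA, ← ENNReal.ofReal_mul' hA0]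
  have hpt : ∀ᵐ x ∂((vol n M).restrict Ω),
      |γ| ^ (p - 2) * γ * (inner ℝ (grad (fun x => |u x| ^ p) x) (‖R x‖ ^ (p - 2) • R x) *
        ρ x ^ (-p + 1 + α)) - (p - 1) * |γ| ^ p * (‖R x‖ ^ p / ρ x ^ (p - α) * |u x| ^ p) +
      δ * (inner ℝ (‖Φ x‖ ^ (p - 2) • Φ x) (grad (fun x => |u x| ^ p) x) * φ x ^ (-p + 1) *
        ρ x ^ α - (p - 1) * (‖Φ x‖ ^ p * |u x| ^ p * ρ x ^ α * φ x ^ (-p)) -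
        p * γ * (inner ℝ (‖Φ x‖ ^ (p - 2) • Φ x) (R x) * |u x| ^ p * φ x ^ (-p + 1) *
          ρ x ^ (-1 + α)) - ε * |γ| ^ p * (‖R x‖ ^ p / ρ x ^ (p - α) * |u x| ^ p)) ≤
      ‖(grad u x : TangentSpace (𝓡 n) x)‖ ^ p * ρ x ^ α := by
    filter_upwards [hρpos, hφpos] with x hx hx'
    rw [grad_abs_rpow (hu.1.mdifferentiable one_ne_zero x) hp]
    exact pointwise_hardy hp hδ (H x) _ _ _ _ _ _ hx hx'
  have j1 := i1.const_mul (|γ| ^ (p - 2) * γ)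
  have j2 := i0.const_mul ((p - 1) * |γ| ^ p)
  have j3 := i3.const_mul (p - 1)
  have j4 := i4.const_mul (p * γ)
  have j5 := i0.const_mul (ε * |γ| ^ p)
  have k3 := (i2.sub j3).sub j4
  refine le_trans (ENNReal.ofReal_le_ofReal ?_)
    (ofReal_integral_le_lintegral ((j1.sub j2).add ((k3.sub j5).const_mul δ)) hpt)
  rw [integral_add' (j1.sub j2) ((k3.sub j5).const_mul δ), integral_sub' j1 j2,
    integral_const_mul, integral_const_mul, integral_const_mul, integral_sub' k3 j5,
    integral_sub' (i2.sub j3) j4, integral_sub' i2 j3, integral_const_mul, integral_const_mul,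
    integral_const_mul, ← hA]
  have e1 : |γ| ^ (p - 2) * γ * γ = |γ| ^ p := abs_rpow_sub_two_mul_mul_self hp0.ne' γ
  have h1 := mul_le_mul_of_nonneg_left le1
    (mul_nonneg hp0.le (Real.rpow_nonneg (abs_nonneg γ) p))
  have h2 := mul_le_mul_of_nonneg_left le2 hδ.le
  set I := ∫ x in Ω, inner ℝ (grad (fun x => |u x| ^ p) x) (‖R x‖ ^ (p - 2) • R x) *
    ρ x ^ (-p + 1 + α) ∂(vol n M)
  -- The sign of `γ` is unknown, but `|γ| ^ p / γ = |γ| ^ (p - 2) * γ` absorbs it.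
  have h3 : p * |γ| ^ p * (1 / (p * γ) * I) = |γ| ^ (p - 2) * γ * I := by
    rw [← e1]; field_simp
  rw [h3] at h1
  linarith

/-! ### Measurability of the norm of a field and of `ρ`. -/

/-- In a chart `‖U‖ ^ 2 = ∑ U_i U_j g_ij` with measurable `U_i` and continuous `g_ij`; countably
many charts cover `Ω`. -/
theorem MeasurableField.aemeasurable_norm [BorelSpace M] [SecondCountableTopology M]
    [IsManifold (𝓡 n) ∞ M]
    [IsContMDiffRiemannianBundle (𝓡 n) ∞ (EuclideanSpace ℝ (Fin n))
      (fun x : M => TangentSpace (𝓡 n) x)] {Ω : Set M} (hΩ : IsOpen Ω)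
    {U : (x : M) → TangentSpace (𝓡 n) x} (hU : MeasurableField Ω U) :
    AEMeasurable (fun x => ‖U x‖) ((vol n M).restrict Ω) := by
  have : IsManifold (𝓡 n) 1 M := IsManifold.of_le (n := ∞) (by simp)
  have : IsContinuousRiemannianBundle (EuclideanSpace ℝ (Fin n))
      (fun x : M => TangentSpace (𝓡 n) x) := by
    obtain ⟨g, hg, hg'⟩ := IsContMDiffRiemannianBundle.exists_contMDiff (IB := 𝓡 n) (n := ∞)
      (F := EuclideanSpace ℝ (Fin n)) (E := fun x : M => TangentSpace (𝓡 n) x)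
    exact ⟨g, hg.continuous, hg'⟩
  have hloc : ∀ x₀ : M, AEMeasurable (fun x => ‖U x‖)
      ((vol n M).restrict (Ω ∩ (chartAt (EuclideanSpace ℝ (Fin n)) x₀).source)) := by
    intro x₀
    set e := trivializationAt (EuclideanSpace ℝ (Fin n)) (TangentSpace (𝓡 n) : M → Type _) x₀
    set S := (chartAt (EuclideanSpace ℝ (Fin n)) x₀).source
    have hS : IsOpen S := (chartAt (EuclideanSpace ℝ (Fin n)) x₀).open_source
    have hbase : e.baseSet = S := TangentBundle.trivializationAt_baseSet x₀
    set b := (EuclideanSpace.basisFun (Fin n) ℝ).toBasis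
    set F : Fin n → (x : M) → TangentSpace (𝓡 n) x := e.localFrame b
    have hF : ∀ i, ContinuousOn (fun x => (⟨x, F i x⟩ : TotalSpace (EuclideanSpace ℝ (Fin n))
        (TangentSpace (𝓡 n) : M → Type _))) S := fun i => by
      rw [← hbase]
      exact (e.contMDiffOn_localFrame_baseSet (I := 𝓡 n) 1 b i).continuousOn
    have hg : ∀ i j, ContinuousOn (fun x => inner ℝ (F i x) (F j x)) S := fun i j =>
      (hF i).inner_bundle (hF j)
    set D : M → EuclideanSpace ℝ (Fin n) := fun x =>
      mfderiv (𝓡 n) (𝓡 n) (chartAt (EuclideanSpace ℝ (Fin n)) x₀) x (U x)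
    have hD : AEMeasurable D ((vol n M).restrict (Ω ∩ S)) := (hU x₀).aemeasurable
    have hUD : ∀ x ∈ S, U x = ∑ i, D x i • F i x := by
      intro x hx
      have hx' : x ∈ e.baseSet := hbase ▸ hx
      have h1 : e.continuousLinearMapAt ℝ x (U x) = D x := by
        have := TangentBundle.continuousLinearMapAt_trivializationAt (I := 𝓡 n) (𝕜 := ℝ) hx
        exact congrArg (fun L => L (U x)) this
      have h2 : ∀ i, F i x = (e.basisAt b hx') i := fun i =>
        e.localFrame_apply_of_mem_baseSet b hx'
      rw [← (e.basisAt b hx').sum_repr (U x)]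
      refine Finset.sum_congr rfl fun i _ => ?_
      rw [h2]
      congr 1
      rw [← h1]
      simp [Trivialization.basisAt, b, e.linearEquivAt_apply, e.coe_linearMapAt_of_mem hx']
    have hnorm : ∀ x ∈ S, Real.sqrt (∑ i, ∑ j, D x i * D x j * inner ℝ (F i x) (F j x)) = ‖U x‖ := by
      intro x hx
      rw [← Real.sqrt_sq (norm_nonneg (U x)), ← real_inner_self_eq_norm_sq]
      conv_rhs => rw [hUD x hx]
      simp only [sum_inner, inner_sum, real_inner_smul_left, real_inner_smul_right]
      congr 1
      refine Finset.sum_congr rfl fun i _ => Finset.sum_congr rfl fun j _ => ?_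
      rw [real_inner_comm]
      ring
    have hm : AEMeasurable (fun x => Real.sqrt (∑ i, ∑ j, D x i * D x j * inner ℝ (F i x) (F j x)))
        ((vol n M).restrict (Ω ∩ S)) := by
      refine AEMeasurable.sqrt ?_
      refine Finset.aemeasurable_fun_sum _ fun i _ => Finset.aemeasurable_fun_sum _ fun j _ => ?_
      have hDi : ∀ i, AEMeasurable (fun x => D x i) ((vol n M).restrict (Ω ∩ S)) := fun i =>
        ((EuclideanSpace.proj i : EuclideanSpace ℝ (Fin n) →L[ℝ] ℝ).measurable).comp_aemeasurable hD
      exact ((hDi i).mul (hDi j)).mul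
        (((hg i j).mono Set.inter_subset_right).aemeasurable (hΩ.inter hS).measurableSet)
    refine hm.congr ((ae_restrict_iff' (hΩ.inter hS).measurableSet).2 (ae_of_all _ fun x hx => ?_))
    exact hnorm x hx.2
  obtain ⟨T, hT, hTu⟩ := TopologicalSpace.isOpen_iUnion_countable
    (fun x₀ : M => (chartAt (EuclideanSpace ℝ (Fin n)) x₀).source)
    (fun x₀ => (chartAt (EuclideanSpace ℝ (Fin n)) x₀).open_source)
  have hcov : Ω = ⋃ x₀ : T, Ω ∩ (chartAt (EuclideanSpace ℝ (Fin n)) (x₀ : M)).source := by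
    rw [← Set.inter_iUnion, eq_comm, Set.inter_eq_left]
    intro x _
    have : x ∈ ⋃ x₀ ∈ T, (chartAt (EuclideanSpace ℝ (Fin n)) x₀).source := by
      rw [hTu]
      exact Set.mem_iUnion.2 ⟨x, mem_chart_source _ x⟩
    simpa using this
  have : Countable T := hT.to_subtype
  rw [hcov]
  exact aemeasurable_iUnion_iff.2 fun x₀ => hloc x₀

theorem HasTruncGradient.aemeasurable [BorelSpace M] [SecondCountableTopology M] {Ω : Set M}
    {ρ : M → ℝ} {R : (x : M) → TangentSpace (𝓡 n) x} (hR : HasTruncGradient Ω ρ R) :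
    AEMeasurable ρ ((vol n M).restrict Ω) := by
  refine aemeasurable_of_tendsto_metrizable_ae atTop
    -- The shift by `1` keeps every truncation level positive.
    (f := fun (k : ℕ) x => min (ρ x) ((k : ℝ) + 1)) (fun k => ?_) (ae_of_all _ fun x => ?_)
  · exact (hR _ (by positivity)).locallyIntegrable.aestronglyMeasurable.aemeasurable
  · refine tendsto_const_nhds.congr' ?_
    filter_upwards [eventually_ge_atTop ⌈ρ x⌉₊] with k hk
    exact (min_eq_left (by linarith [Nat.ceil_le.1 hk])).symm

/-! ### Passage to the closure of the test functions. -/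

/-- A weighted Hardy inequality extends from test functions to their closure. -/
theorem hardyInequality_of_isTest [BorelSpace M] [SecondCountableTopology M]
    [IsManifold (𝓡 n) ∞ M]
    [IsContMDiffRiemannianBundle (𝓡 n) ∞ (EuclideanSpace ℝ (Fin n))
      (fun x : M => TangentSpace (𝓡 n) x)] {Ω : Set M} (hΩ : IsOpen Ω) {p α c : ℝ} (hp : 1 < p)
    {ρ : M → ℝ} {R : (x : M) → TangentSpace (𝓡 n) x}
    (hρpos : ∀ᵐ x ∂((vol n M).restrict Ω), 0 < ρ x)
    (hρm : AEMeasurable ρ ((vol n M).restrict Ω))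
    (hRm : AEMeasurable (fun x => ‖R x‖ ^ p / ρ x ^ (p - α)) ((vol n M).restrict Ω))
    (H : ∀ u : M → ℝ, IsTest n Ω u → ENNReal.ofReal c *
      ∫⁻ x in Ω, ENNReal.ofReal (|u x| ^ p * ‖R x‖ ^ p / ρ x ^ p * ρ x ^ α) ∂(vol n M) ≤
      ∫⁻ x in Ω, ENNReal.ofReal (‖(grad u x : TangentSpace (𝓡 n) x)‖ ^ p * ρ x ^ α) ∂(vol n M)) :
    HardyInequality p α Ω ρ R c := by
  intro u U hu
  obtain ⟨hum, hUm, f, hf, hfu, hfU⟩ := hu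
  set μ := (vol n M).restrict Ω
  have hp0 : 0 < p := by linarith
  have hUn : AEMeasurable (fun x => ‖U x‖) μ := hUm.aemeasurable_norm hΩ
  obtain ⟨ns, hns, hae⟩ : ∃ ns : ℕ → ℕ, StrictMono ns ∧
      ∀ᵐ x ∂μ, Tendsto (fun k => f (ns k) x) atTop (𝓝 (u x)) := by
    have hfm : ∀ k, AEStronglyMeasurable (f k) μ := fun k =>
      (hf k).1.continuous.aestronglyMeasurable
    have hm : TendstoInMeasure μ (fun k x => |f k x - u x| ^ p) atTop (fun _ => (0 : ℝ)) := by
      refine tendstoInMeasure_of_tendsto_eLpNorm (p := 1) one_ne_zero (fun k => ?_)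
        aestronglyMeasurable_const ?_
      · exact ((((hfm k).sub hum).aemeasurable.abs).pow_const p).aestronglyMeasurable
      · refine hfu.congr fun k => ?_
        rw [eLpNorm_one_eq_lintegral_enorm]
        refine lintegral_congr fun x => ?_
        rw [← Real.enorm_of_nonneg (by positivity)]
        simp
    obtain ⟨ns, hns, hae⟩ := hm.exists_seq_tendsto_ae
    refine ⟨ns, hns, hae.mono fun x hx => ?_⟩
    have h1 := (hx.rpow_const (p := p⁻¹) (Or.inr (by positivity)))
    rw [Real.zero_rpow (by positivity)] at h1
    refine tendsto_sub_nhds_zero_iff.1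
      ((tendsto_zero_iff_abs_tendsto_zero _).2 (h1.congr fun k => ?_))
    exact Real.rpow_rpow_inv (abs_nonneg _) hp0.ne'
  set A := ∫⁻ x, ENNReal.ofReal (|u x| ^ p * ‖R x‖ ^ p / ρ x ^ p * ρ x ^ α) ∂μ with hA
  set B := ∫⁻ x, ENNReal.ofReal (‖U x‖ ^ p * ρ x ^ α) ∂μ with hB
  -- Fatou along an a.e. convergent subsequence: no bound on the Hardy integral of `u` is known
  -- beforehand.
  have hfatou : A ≤ liminf (fun k =>
      ∫⁻ x, ENNReal.ofReal (|f (ns k) x| ^ p * ‖R x‖ ^ p / ρ x ^ p * ρ x ^ α) ∂μ) atTop := by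
    have hmeas : ∀ k, AEMeasurable (fun x =>
        ENNReal.ofReal (|f (ns k) x| ^ p * ‖R x‖ ^ p / ρ x ^ p * ρ x ^ α)) μ := fun k => by
      have h1 : AEMeasurable (fun x => |f (ns k) x| ^ p * (‖R x‖ ^ p / ρ x ^ (p - α))) μ :=
        (((hf (ns k)).1.continuous.measurable.abs.pow_const p).aemeasurable).mul hRm
      refine (h1.congr (hρpos.mono fun x hx => ?_)).ennreal_ofReal
      simp only
      rw [Real.rpow_sub hx]
      field_simp
    refine le_trans (le_of_eq (lintegral_congr_ae ?_)) (lintegral_liminf_le' hmeas)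
    filter_upwards [hae] with x hx
    refine (Tendsto.liminf_eq (ENNReal.tendsto_ofReal ?_)).symm
    exact (((hx.abs.rpow_const (Or.inr hp0.le)).mul_const _).div_const _).mul_const _
  -- For fixed `l` the error term, with its large factor `(1 - l) ^ (1 - p)`, vanishes as `k → ∞`;
  -- only then does `l → 1`. This also covers `B = ∞`.
  have hl : ∀ l ∈ Set.Ioo (0 : ℝ) 1, ENNReal.ofReal c * A ≤ ENNReal.ofReal (l ^ (1 - p)) * B := by
    rintro l ⟨hl0, hl1⟩
    have hbound : ∀ k, ENNReal.ofReal c *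
        ∫⁻ x, ENNReal.ofReal (|f (ns k) x| ^ p * ‖R x‖ ^ p / ρ x ^ p * ρ x ^ α) ∂μ ≤
        ENNReal.ofReal (l ^ (1 - p)) * B + ENNReal.ofReal ((1 - l) ^ (1 - p)) *
          ∫⁻ x, ENNReal.ofReal (‖(grad (f (ns k)) x - U x : TangentSpace (𝓡 n) x)‖ ^ p *
            (1 + ρ x ^ α)) ∂μ := by
      intro k
      refine (H _ (hf (ns k))).trans ?_
      rw [hB, ← lintegral_const_mul' _ _ ENNReal.ofReal_ne_top,
        ← lintegral_const_mul' _ _ ENNReal.ofReal_ne_top, ← lintegral_add_left']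
      · refine lintegral_mono_ae (hρpos.mono fun x hx => ?_)
        have hl2 : 0 < 1 - l := by linarith
        have hρx : 0 < ρ x ^ α := by positivity
        rw [← ENNReal.ofReal_mul (by positivity), ← ENNReal.ofReal_mul (by positivity),
          ← ENNReal.ofReal_add (by positivity) (by positivity)]
        refine ENNReal.ofReal_le_ofReal ?_
        set G : TangentSpace (𝓡 n) x := grad (f (ns k)) x
        have h1 : ‖G‖ ^ p ≤ (‖U x‖ + ‖G - U x‖) ^ p := by
          refine Real.rpow_le_rpow (norm_nonneg _) ?_ hp0.le
          exact norm_le_norm_add_norm_sub' G (U x)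
        have h2 := h1.trans (add_rpow_le hp.le hl0 hl1 (norm_nonneg (U x)) (norm_nonneg (G - U x)))
        have h3 := mul_le_mul_of_nonneg_right h2 hρx.le
        have h4 : 0 ≤ (1 - l) ^ (1 - p) * ‖G - U x‖ ^ p := by positivity
        linarith
      · exact ((((hUn.pow_const p).mul (hρm.pow_const α)).ennreal_ofReal).const_mul _)
    have hlim : Tendsto (fun k => ENNReal.ofReal (l ^ (1 - p)) * B +
        ENNReal.ofReal ((1 - l) ^ (1 - p)) * ∫⁻ x, ENNReal.ofReal
          (‖(grad (f (ns k)) x - U x : TangentSpace (𝓡 n) x)‖ ^ p * (1 + ρ x ^ α)) ∂μ) atTop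
        (𝓝 (ENNReal.ofReal (l ^ (1 - p)) * B)) := by
      have := ENNReal.Tendsto.const_mul (a := ENNReal.ofReal ((1 - l) ^ (1 - p)))
        (hfU.comp hns.tendsto_atTop) (Or.inr ENNReal.ofReal_ne_top)
      simpa using this.const_add (ENNReal.ofReal (l ^ (1 - p)) * B)
    calc ENNReal.ofReal c * A
        ≤ ENNReal.ofReal c * liminf (fun k => ∫⁻ x, ENNReal.ofReal
          (|f (ns k) x| ^ p * ‖R x‖ ^ p / ρ x ^ p * ρ x ^ α) ∂μ) atTop := by gcongr
      _ = liminf (fun k => ENNReal.ofReal c * ∫⁻ x, ENNReal.ofReal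
          (|f (ns k) x| ^ p * ‖R x‖ ^ p / ρ x ^ p * ρ x ^ α) ∂μ) atTop :=
        (ENNReal.liminf_const_mul_of_ne_top ENNReal.ofReal_ne_top).symm
      _ ≤ _ := (liminf_le_liminf (Eventually.of_forall hbound)).trans hlim.liminf_eq.le
  have hlim : Tendsto (fun l : ℝ => ENNReal.ofReal (l ^ (1 - p)) * B) (𝓝[<] 1) (𝓝 B) := by
    have h1 : Tendsto (fun l : ℝ => ENNReal.ofReal (l ^ (1 - p))) (𝓝[<] 1) (𝓝 1) := by
      have : ContinuousAt (fun l : ℝ => ENNReal.ofReal (l ^ (1 - p))) 1 :=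
        ENNReal.continuous_ofReal.continuousAt.comp
          (Real.continuousAt_rpow_const 1 (1 - p) (Or.inl one_ne_zero))
      simpa [ContinuousAt] using this.tendsto.mono_left nhdsWithin_le_nhds
    simpa using ENNReal.Tendsto.mul_const h1 (Or.inl one_ne_zero)
  refine ge_of_tendsto hlim ?_
  filter_upwards [Ioo_mem_nhdsLT (zero_lt_one (α := ℝ))] with l hl' using hl l hl'

end RiemHardy

/-! ### The choice of constants. -/

theorem corollary1p3 {n : ℕ} {M : Type*} [EMetricSpace M] [CompleteSpace M]
    [SecondCountableTopology M] [MeasurableSpace M] [BorelSpace M]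
    [ChartedSpace (EuclideanSpace ℝ (Fin n)) M] [IsManifold (𝓡 n) ∞ M]
    [RiemannianBundle (fun x : M => TangentSpace (𝓡 n) x)]
    [IsContMDiffRiemannianBundle (𝓡 n) ∞ (EuclideanSpace ℝ (Fin n))
      (fun x : M => TangentSpace (𝓡 n) x)]
    [IsRiemannianManifold (𝓡 n) M]
    (Ω : Set M) (hΩ : IsOpen Ω) (hΩc : IsConnected Ω)
    (p α β : ℝ) (hp : 1 < p) (hβ : p - 1 + β ≠ 0)
    (ρ : M → ℝ) (R : (x : M) → TangentSpace (𝓡 n) x)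
    (hρpos : ∀ᵐ x ∂((RiemHardy.vol n M).restrict Ω), 0 < ρ x)
    (hR : RiemHardy.HasTruncGradient Ω ρ R)
    (hRp : LocallyIntegrableOn (fun x => (‖R x‖ * ρ x ^ ((-p + α) / p)) ^ p) Ω
      (RiemHardy.vol n M))
    (hρ : RiemHardy.RhoCondition p α β Ω ρ R)
    (C K : ℝ) (hC : 0 < C) (hK : 0 < K)
    (φ : M → ℝ) (Φ : (x : M) → TangentSpace (𝓡 n) x)
    (hφ : RiemHardy.InW1pLoc p Ω φ Φ)
    (hφpos : ∀ᵐ x ∂((RiemHardy.vol n M).restrict Ω), 0 < φ x)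
    (hode : RiemHardy.WeakSupersolution p α β Ω ρ R φ Φ
      (fun x => C * (‖R x‖ ^ p / ρ x ^ p) / K)) :
    ∃ c : ℝ, (|p - 1 + β| / p) ^ p < c ∧ RiemHardy.HardyInequality p α Ω ρ R c := by
  have hp0 : 0 < p := by linarith
  set G := (|p - 1 + β| / p) ^ p
  have hG : 0 < G := Real.rpow_pos_of_pos (div_pos (abs_pos.2 hβ) hp0) p
  have hCK : 0 < C / K := div_pos hC hK
  -- This `ε` makes the loss `ε * G` half of the gain `C / K`, so the constant grows by `δ * C / (2
  -- * K)`.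
  obtain ⟨δ, hδ, H⟩ := RiemHardy.exists_norm_add_rpow_ge hp (ε := C / K / (2 * G)) (by positivity)
  have heq : ∀ᵐ x ∂((RiemHardy.vol n M).restrict Ω),
      (‖R x‖ * ρ x ^ ((-p + α) / p)) ^ p = ‖R x‖ ^ p / ρ x ^ (p - α) := by
    filter_upwards [hρpos] with x hx
    rw [Real.mul_rpow (norm_nonneg _) (by positivity), ← Real.rpow_mul hx.le,
      div_mul_cancel₀ _ hp0.ne', div_eq_mul_inv, ← Real.rpow_neg hx.le]
    congr 2
    ring
  have hRint : LocallyIntegrableOn (fun x => ‖R x‖ ^ p / ρ x ^ (p - α)) Ω (RiemHardy.vol n M) := by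
    intro x hx
    obtain ⟨t, ht, hti⟩ := hRp x hx
    refine ⟨t ∩ Ω, inter_mem ht self_mem_nhdsWithin,
      (hti.mono_set Set.inter_subset_left).congr ?_⟩
    exact ae_restrict_of_ae_restrict_of_subset Set.inter_subset_right heq
  have hode' : RiemHardy.WeakSupersolution p α β Ω ρ R φ Φ
      (fun x => C / K * (‖R x‖ ^ p / ρ x ^ p)) := by
    convert hode using 2
    ring
  refine ⟨G + δ * (C / K - C / K / (2 * G) * G), ?_,
    RiemHardy.hardyInequality_of_isTest hΩ hp hρpos hR.aemeasurable
      hRint.aestronglyMeasurable.aemeasurable fun u hu => ?_⟩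
  · have : C / K / (2 * G) * G = C / K / 2 := by field_simp
    rw [this]
    have : 0 < δ * (C / K - C / K / 2) := mul_pos hδ (by linarith)
    linarith
  · exact hu.hardy hΩ hp hβ hρpos hRint hρ hδ hφpos hode' fun x a b => H _ a b
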